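/- Setting. A represented space is a set $\mathbf{X}$ with a partial surjection $\delta$ from $\mathbb{N}^{\mathbb{N}}$ onto it; $p$ is a name of $\delta(p)$. A partial multivalued function between represented spaces is computable if some Type-2 computable partial function on $\mathbb{N}^{\mathbb{N}}$ maps every name of every point $x$ of its domain to a name of one of its values at $x$. A computable sequence in a represented space is a sequence of points that has a computable sequence of names. The space $\mathcal{O}(\mathbf{X})$ consists of the open subsets $U$ of $\mathbf{X}$ (those for which $\delta^{-1}(U)$ is relatively open in $\operatorname{dom}(\delta)$), a name of $U$ being an enumeration of finite words such that, for every name $q$ of a point $x$, $x\in U$ iff some enumerated word is a prefix of $q$. The space $\mathcal{A}(\mathbf{X})$ consists of the closed sets $A$, named by the names of $\mathbf{X}\setminus A$ in $\mathcal{O}(\mathbf{X})$. The space $\mathcal{V}(\mathbf{X})$ consists of the closed sets $A$, named by the names of $\{U\in\mathcal{O}(\mathbf{X}) \mid U\cap A\neq\emptyset\}$ in $\mathcal{O}(\mathcal{O}(\mathbf{X}))$. The space $\mathcal{K}(\mathbf{X})$ consists of the saturated sets $K$ for which $\{U\in\mathcal{O}(\mathbf{X}) \mid K\subseteq U\}$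 is open in $\mathcal{O}(\mathbf{X})$, named by the names of this set in $\mathcal{O}(\mathcal{O}(\mathbf{X}))$. A name of $A$ in $(\mathcal{A}\wedge\mathcal{V})(\mathbf{X})$ is a pair consisting of an $\mathcal{A}(\mathbf{X})$-name and a $\mathcal{V}(\mathbf{X})$-name of $A$. The space $\mathbb{T}=\{0,1,\bot\}$ is represented as follows: a name is a sequence that may at some time announce that the value is $0$, or that it is $1$ (never both); a sequence without any announcement is a name of $\bot$. $\mathbb{T}^\omega$ is its countable power. An effective relatively compact system (ercs) of $\mathbf{X}$ consists of a computable sequence $(U_n)_{n\in\mathbb{N}}$ in $\mathcal{O}(\mathbf{X})$, a computable sequence $(B_n)_{n\in\mathbb{N}}$ in $\mathcal{K}(\mathbf{X})$, and a computably enumerable relation $R\subseteq\mathbb{N}\times\mathbb{N}$ such that $(m,n)\in R$ implies $U_m\subseteq B_n$, and such that every $U\in\mathcal{O}(\mathbf{X})$ satisfies $$U=\bigcup_{\{n\mid U\supseteq B_n\}}\ \bigcup_{\{m\mid (m,n)\in R\}}U_m .$$ Proposition. Let $\mathbf{X}$ be a represented space that admits an ercs. Then $(\mathcal{A}\wedge\mathcal{V})(\mathbf{X})$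 computably embeds into $\mathbb{T}^\omega$: there is an injective computable function $\varphi:(\mathcal{A}\wedge\mathcal{V})(\mathbf{X})\to\mathbb{T}^\omega$ whose partial inverse $\varphi^{-1}:\subseteq\mathbb{T}^\omega\to(\mathcal{A}\wedge\mathcal{V})(\mathbf{X})$ is computable. Consequently, $\mathbf{Y}=(\mathcal{A}\wedge\mathcal{V})(\mathbf{X})$ admits an effective countable basis: there is a computable sequence $(W_n)_{n\in\mathbb{N}}$ in $\mathcal{O}(\mathbf{Y})$ that is a basis, i.e. whenever $y\in W\in\mathcal{O}(\mathbf{Y})$ there is $n$ with $y\in W_n\subseteq W$, and such an $n$ can be computed from $y\in\mathbf{Y}$ and $W\in\mathcal{O}(\mathbf{Y})$. -/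

import Mathlib

universe u v

namespace TTE

/-- The finite word `p 0, …, p (k - 1)`. -/
def initSeg (p : ℕ → ℕ) (k : ℕ) : List ℕ := (List.range k).map p

/-- The pairing of names: `p = ⟨evens p, odds p⟩`. -/
def evens (p : ℕ → ℕ) : ℕ → ℕ := fun n => p (2 * n)

def odds (p : ℕ → ℕ) : ℕ → ℕ := fun n => p (2 * n + 1)

/-- The `n`-th component of a name of a sequence. -/
def row (p : ℕ → ℕ) (n : ℕ) : ℕ → ℕ := fun k => p (Nat.pair n k)

/-- A representation of `X`: a partial surjection from Baire space `ℕ → ℕ` onto `X`, given by its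
graph. `Names p x` says that `p` is a name of `x`. -/
structure Representation (X : Type u) where
  Names : (ℕ → ℕ) → X → Prop
  unique : ∀ {p x y}, Names p x → Names p y → x = y
  surj : ∀ x, ∃ p, Names p x

namespace Representation

variable {X : Type u} {Y : Type v}

/-- The word function `h` maps longer and longer prefixes of the input `p` to longer and longer
prefixes of the output `q`. -/
def Computes (h : List ℕ → List ℕ) (p q : ℕ → ℕ) : Prop :=
  ∀ n, ∃ k, (h (initSeg p k))[n]? = some (q n)

/-- A partial multivalued function `f : ⊆ X ⇉ Y` (with domain `{x | ∃ y, f x y}`) is computable if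
it has a computable realizer, that is, a Type-2 computable partial function on Baire space, induced
by a computable monotone word function, which maps each name of each `x` in the domain to a name
of some `y` with `f x y`. -/
def ComputableMulti (δ : Representation X) (ε : Representation Y) (f : X → Y → Prop) : Prop :=
  ∃ h : List ℕ → List ℕ, Computable h ∧ (∀ σ τ, σ <+: τ → h σ <+: h τ) ∧
    ∀ p x, δ.Names p x → (∃ y, f x y) →
      ∃ q y, Computes h p q ∧ ε.Names q y ∧ f x y

/-- Computability of a (total, single-valued) function between represented spaces. -/
def ComputableFun (δ : Representation X) (ε : Representation Y) (f : X → Y) : Prop :=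
  ComputableMulti δ ε (fun x y => f x = y)

/-- A computable embedding: `f` is injective, and `f` and its partial inverse are computable. -/
def ComputableEmbedding (δ : Representation X) (ε : Representation Y) (f : X → Y) : Prop :=
  Function.Injective f ∧ ComputableFun δ ε f ∧ ComputableMulti ε δ (fun y x => f x = y)

/-- A computable sequence of points: there is a computable sequence of names. -/
def ComputableSeq (δ : Representation X) (x : ℕ → X) : Prop :=
  ∃ u : ℕ → ℕ → ℕ, Computable (fun a : ℕ × ℕ => u a.1 a.2) ∧ ∀ n, δ.Names (u n) (x n)

/-- The natural numbers: `p` is a name of `p 0`. -/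
def nat : Representation ℕ where
  Names p n := p 0 = n
  unique h h' := h.symm.trans h'
  surj n := ⟨fun _ => n, rfl⟩

/-- The product of represented spaces. -/
def prod (δ : Representation X) (ε : Representation Y) : Representation (X × Y) where
  Names p z := δ.Names (evens p) z.1 ∧ ε.Names (odds p) z.2
  unique h h' := Prod.ext (δ.unique h.1 h'.1) (ε.unique h.2 h'.2)
  surj z := by
    obtain ⟨p, hp⟩ := δ.surj z.1
    obtain ⟨q, hq⟩ := ε.surj z.2
    refine ⟨fun n => if n % 2 = 0 then p (n / 2) else q (n / 2), ?_, ?_⟩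
    · convert hp using 1
      funext n
      simp [evens]
    · convert hq using 1
      funext n
      simp only [odds]
      rw [if_neg (by omega)]
      congr 1
      omega

/-- The meet `δ ∧ ε` of two representations of the same set: a name of `x` is a pair consisting of
a `δ`-name and an `ε`-name of `x`. -/
def meet (δ ε : Representation X) : Representation X where
  Names p x := (δ.prod ε).Names p (x, x)
  unique h h' := δ.unique h.1 h'.1
  surj x := (δ.prod ε).surj (x, x)

/-- The countable power `X^ω` of a represented space. -/
def power (δ : Representation X) : Representation (ℕ → X) where
  Names p x := ∀ n, δ.Names (row p n) (x n)
  unique h h' := funext fun n => δ.unique (h n) (h' n)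
  surj x := by
    choose p hp using fun n => δ.surj (x n)
    refine ⟨fun m => p m.unpair.1 m.unpair.2, fun n => ?_⟩
    convert hp n using 1
    funext k
    simp [row]

/-- The space `𝕋 = {0, 1, ⊥}`, with `none` as `⊥`, `some false` as `0` and `some true` as `1`.
An entry `1` in a name says that the value is `0`, an entry `2` says that the value is `1`, all
other entries carry no information; a name of `⊥` never gives any information. -/
def three : Representation (Option Bool) where
  Names p t := ∀ b : Bool, t = some b ↔ ∃ n, p n = b.toNat + 1
  unique {p x y} h h' := by
    apply Option.ext
    intro b
    exact (h b).trans (h' b).symm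
  surj t := by
    cases t with
    | none => exact ⟨fun _ => 0, fun b => by simp⟩
    | some c => exact ⟨fun _ => c.toNat + 1, fun b => by cases b <;> cases c <;> simp⟩

/-- `p` enumerates finite words (the entry `0` means "no word now"), and `U` is the set of those
points whose names have a prefix among these words. Thus `p` describes a realizer of the
characteristic function of `U` as a continuous map into Sierpiński space. -/
def NamesOpen (δ : Representation X) (p : ℕ → ℕ) (U : Set X) : Prop :=
  ∀ q x, δ.Names q x → (x ∈ U ↔ ∃ i k, p i = Encodable.encode (initSeg q k) + 1)

/-- The open sets of a represented space: the sets whose set of names is relatively open in the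
set of all names. -/
def OpenSets (δ : Representation X) : Type u := {U : Set X // ∃ p, δ.NamesOpen p U}

/-- The closed sets: the complements of the open sets. -/
def ClosedSets (δ : Representation X) : Type u := {A : Set X // ∃ p, δ.NamesOpen p Aᶜ}

theorem NamesOpen.unique {δ : Representation X} {p : ℕ → ℕ} {U V : Set X}
    (h : δ.NamesOpen p U) (h' : δ.NamesOpen p V) : U = V := by
  ext x
  obtain ⟨q, hq⟩ := δ.surj x
  exact (h q x hq).trans (h' q x hq).symm

/-- The hyperspace `𝒪(X)` of open sets. -/
def opens (δ : Representation X) : Representation δ.OpenSets where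
  Names p U := δ.NamesOpen p U.1
  unique h h' := Subtype.ext (h.unique h')
  surj U := U.2

/-- The hyperspace `𝒜(X)` of closed sets: a name of `A` is a name of its complement in `𝒪(X)`. -/
def closeds (δ : Representation X) : Representation δ.ClosedSets where
  Names p A := δ.NamesOpen p A.1ᶜ
  unique h h' := Subtype.ext (compl_injective (h.unique h'))
  surj A := A.2

/-- The set of all open sets that contain `K`. -/
def openNhds (δ : Representation X) (K : Set X) : Set δ.OpenSets := {U | K ⊆ U.1}

/-- The set of all open sets that meet `A`. -/
def openHits (δ : Representation X) (A : Set X) : Set δ.OpenSets := {U | (U.1 ∩ A).Nonempty}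

/-- The compact sets of a represented space: saturated sets `K` (intersections of open sets) for
which `{U ∈ 𝒪(X) | K ⊆ U}` is an open subset of `𝒪(X)`. -/
def CompactSets (δ : Representation X) : Type u :=
  {K : Set X // K = ⋂ U ∈ δ.openNhds K, U.1 ∧ ∃ p, δ.opens.NamesOpen p (δ.openNhds K)}

/-- The hyperspace `𝒦(X)` of compact sets: a name of `K` is a name of
`{U ∈ 𝒪(X) | K ⊆ U}` in `𝒪(𝒪(X))`. -/
def compacts (δ : Representation X) : Representation δ.CompactSets where
  Names p K := δ.opens.NamesOpen p (δ.openNhds K.1)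
  unique {p K L} h h' := by
    apply Subtype.ext
    rw [K.2.1, L.2.1, h.unique h']
  surj K := K.2.2

theorem exists_names_openHits (δ : Representation X) (A : Set X) :
    ∃ p, δ.opens.NamesOpen p (δ.openHits A) := by
  classical
  let good : List ℕ → Prop := fun w => ∃ q x m, δ.Names q x ∧ x ∈ A ∧
    Encodable.encode (initSeg q m) + 1 ∈ w
  refine ⟨fun i => if ∃ w, Encodable.encode w = i ∧ good w then i + 1 else 0, fun u U hu => ?_⟩
  constructor
  · rintro ⟨x, hxU, hxA⟩
    obtain ⟨q, hq⟩ := δ.surj x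
    obtain ⟨i, k, hi⟩ := (hu q x hq).1 hxU
    refine ⟨Encodable.encode (initSeg u (i + 1)), i + 1, ?_⟩
    refine if_pos ?_
    refine ⟨_, rfl, q, x, k, hq, hxA, ?_⟩
    rw [← hi]
    exact List.mem_map.2 ⟨i, List.mem_range.2 (Nat.lt_succ_self i), rfl⟩
  · rintro ⟨i, k, hi⟩
    dsimp only at hi
    split_ifs at hi with h
    obtain ⟨w, hw, q, x, m, hq, hxA, hmem⟩ := h
    have hwu : w = initSeg u k := Encodable.encode_injective (by omega)
    rw [hwu] at hmem
    obtain ⟨j, -, hj⟩ := List.mem_map.1 hmem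
    exact ⟨x, (hu q x hq).2 ⟨j, m, hj⟩, hxA⟩

/-- The hyperspace `𝒱(X)` of overt sets: a name of the closed set `A` is a name of
`{U ∈ 𝒪(X) | U ∩ A ≠ ∅}` in `𝒪(𝒪(X))`. -/
def overts (δ : Representation X) : Representation δ.ClosedSets where
  Names p A := δ.opens.NamesOpen p (δ.openHits A.1)
  unique {p A B} h h' := by
    have key : ∀ U : δ.OpenSets, (U.1 ∩ A.1).Nonempty ↔ (U.1 ∩ B.1).Nonempty := fun U =>
      Set.ext_iff.1 (h.unique h') U
    have h1 := key ⟨A.1ᶜ, A.2⟩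
    have h2 := key ⟨B.1ᶜ, B.2⟩
    apply Subtype.ext
    ext x
    constructor
    · intro hx
      by_contra hxB
      obtain ⟨y, hy, hy'⟩ := h2.1 ⟨x, hxB, hx⟩
      exact hy hy'
    · intro hx
      by_contra hxA
      obtain ⟨y, hy, hy'⟩ := h1.2 ⟨x, hxA, hx⟩
      exact hy hy'
  surj A := δ.exists_names_openHits A.1

/-- The hyperspace `(𝒜 ∧ 𝒱)(X)` of sets given as both closed and overt. -/
def closedOverts (δ : Representation X) : Representation δ.ClosedSets :=
  δ.closeds.meet δ.overts

/-- An effective relatively compact system. -/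
structure IsErcs (δ : Representation X) (U : ℕ → δ.OpenSets) (B : ℕ → δ.CompactSets)
    (R : ℕ → ℕ → Prop) : Prop where
  computable_opens : δ.opens.ComputableSeq U
  computable_compacts : δ.compacts.ComputableSeq B
  enumerable : REPred (fun a : ℕ × ℕ => R a.1 a.2)
  subset_of_rel : ∀ m n, R m n → (U m).1 ⊆ (B n).1
  eq_iUnion : ∀ W : δ.OpenSets,
    W.1 = ⋃ n ∈ {n | (B n).1 ⊆ W.1}, ⋃ m ∈ {m | R m n}, (U m).1

/-- `X` admits an ercs. -/
def AdmitsErcs (δ : Representation X) : Prop :=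
  ∃ U B R, δ.IsErcs U B R

/-- An effective countable basis: a computable sequence `(U n)` of open sets that is a basis and
such that from a point `x` and an open set `W` with `x ∈ W` one can compute some `n` with
`x ∈ U n ⊆ W`. -/
def IsEffectiveBasis (δ : Representation X) (U : ℕ → δ.OpenSets) : Prop :=
  δ.opens.ComputableSeq U ∧
    (∀ (x : X) (W : δ.OpenSets), x ∈ W.1 → ∃ n, x ∈ (U n).1 ∧ (U n).1 ⊆ W.1) ∧
    ComputableMulti (δ.prod δ.opens) nat
      (fun z n => z.1 ∈ z.2.1 ∧ z.1 ∈ (U n).1 ∧ (U n).1 ⊆ z.2.1)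

end Representation

end TTE

/-! Enumerate the pairs (m, n) in R and send A to the sequence whose coordinate at (m, n) is 1 if
U_m meets A, 0 if B_n misses A, and ⊥ otherwise. The first two cases exclude each other since U_m ⊆
B_n. Both are semidecidable from a name of A: feed the name of U_m to the overt part, and the closed
part to the name of B_n.

Conversely, the covering identity of the ercs recovers A. Applied to the complement of A, it gives
Aᶜ as the union of the U_m whose coordinate is 0 (`IsErcs.mem_compl_iff`). Applied to an open V, it
shows that V meets A iff some coordinate 1 has B_n ⊆ V (`IsErcs.inter_nonempty_iff`). Names of open
sets and of 𝕋 may contain idle entries, so both realizers can emit one symbol per input symbol and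
postpone every positive answer until enough input has been read.

The basis exists for any Y that embeds computably into 𝕋^ω by φ. Its members are the sets of y such
that φ y agrees with all announcements in a finite word ζ. To find one between y and V, compute
longer and longer prefixes ζ of a name of φ y, until the inverse realizer has produced from ζ a word
that the name of V accepts. Every y' for which φ y' agrees with ζ has a name of φ y' starting with
ζ, so y' is accepted too. -/

namespace TTE

/-! ### Word functions as realizers -/

section WordFunctions

@[simp] theorem length_initSeg (p : ℕ → ℕ) (k : ℕ) : (initSeg p k).length = k := by
  simp [initSeg]

theorem getElem?_initSeg (p : ℕ → ℕ) {k n : ℕ} (h : n < k) : (initSeg p k)[n]? = some (p n) := by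
  simp [initSeg, h]

theorem take_initSeg (p : ℕ → ℕ) (k m : ℕ) : (initSeg p k).take m = initSeg p (min m k) := by
  simp [initSeg, ← List.map_take, List.take_range]

theorem initSeg_prefix (p : ℕ → ℕ) {k m : ℕ} (h : k ≤ m) : initSeg p k <+: initSeg p m := by
  rw [List.prefix_iff_eq_take, take_initSeg]
  simp [h]

theorem eq_initSeg_of_getElem? {p : ℕ → ℕ} {σ : List ℕ}
    (h : ∀ n < σ.length, σ[n]? = some (p n)) : σ = initSeg p σ.length := by
  apply List.ext_getElem?
  intro n
  by_cases hn : n < σ.length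
  · rw [h n hn, getElem?_initSeg p hn]
  · rw [List.getElem?_eq_none (by omega), List.getElem?_eq_none (by simpa using hn)]

theorem getElem?_of_prefix {σ τ : List ℕ} (h : σ <+: τ) {n a : ℕ} (ha : σ[n]? = some a) :
    τ[n]? = some a := by
  obtain ⟨ρ, rfl⟩ := h
  rw [List.getElem?_append_left (List.getElem?_eq_some_iff.1 ha).1, ha]

/-- By monotonicity, the output on a prefix of length k and the output that exhibits symbol n of q
are both prefixes of the output on a common longer input. -/
theorem Representation.Computes.eq_initSeg {h : List ℕ → List ℕ}
    (hm : ∀ σ τ, σ <+: τ → h σ <+: h τ) {p q : ℕ → ℕ} (hc : Computes h p q) (k : ℕ) :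
    h (initSeg p k) = initSeg q (h (initSeg p k)).length := by
  apply eq_initSeg_of_getElem?
  intro n hn
  obtain ⟨l, hl⟩ := hc n
  have h1 := getElem?_of_prefix (hm _ _ (initSeg_prefix p (le_max_right k l))) hl
  have h2 := List.getElem?_eq_getElem hn
  rw [h2, ← getElem?_of_prefix (hm _ _ (initSeg_prefix p (le_max_left k l))) h2, h1]

theorem Representation.Computes.exists_le_length {h : List ℕ → List ℕ}
    (hm : ∀ σ τ, σ <+: τ → h σ <+: h τ) {p q : ℕ → ℕ} (hc : Computes h p q) (n : ℕ) :
    ∃ k, ∀ l ≥ k, n ≤ (h (initSeg p l)).length := by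
  cases n with
  | zero => simp
  | succ n =>
    obtain ⟨k, hk⟩ := hc n
    refine ⟨k, fun l hl => ?_⟩
    exact (List.getElem?_eq_some_iff.1
      (getElem?_of_prefix (hm _ _ (initSeg_prefix p hl)) hk)).1

/-- The even positions of a word. -/
def evensWord (σ : List ℕ) : List ℕ :=
  (List.range ((σ.length + 1) / 2)).map fun n => σ.getD (2 * n) 0

/-- The odd positions of a word. -/
def oddsWord (σ : List ℕ) : List ℕ :=
  (List.range (σ.length / 2)).map fun n => σ.getD (2 * n + 1) 0

theorem evensWord_initSeg (p : ℕ → ℕ) (k : ℕ) :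
    evensWord (initSeg p k) = initSeg (evens p) ((k + 1) / 2) := by
  simp only [evensWord, length_initSeg]
  apply List.map_congr_left
  intro n hn
  rw [List.mem_range] at hn
  rw [List.getD_eq_getElem?_getD, getElem?_initSeg p (by omega)]
  rfl

theorem oddsWord_initSeg (p : ℕ → ℕ) (k : ℕ) :
    oddsWord (initSeg p k) = initSeg (odds p) (k / 2) := by
  simp only [oddsWord, length_initSeg]
  apply List.map_congr_left
  intro n hn
  rw [List.mem_range] at hn
  rw [List.getD_eq_getElem?_getD, getElem?_initSeg p (by omega)]
  rfl

theorem primrec_evensWord : Primrec evensWord := by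
  refine Primrec.list_map (Primrec.list_range.comp
    (Primrec.nat_div.comp (Primrec.succ.comp Primrec.list_length) (Primrec.const 2))) ?_
  exact (Primrec.list_getD 0).comp Primrec.fst
    (Primrec.nat_mul.comp (Primrec.const 2) Primrec.snd)

theorem primrec_oddsWord : Primrec oddsWord := by
  refine Primrec.list_map (Primrec.list_range.comp
    (Primrec.nat_div.comp Primrec.list_length (Primrec.const 2))) ?_
  exact (Primrec.list_getD 0).comp Primrec.fst
    (Primrec.succ.comp (Primrec.nat_mul.comp (Primrec.const 2) Primrec.snd))

theorem computable_map_range {α β : Type*} [Primcodable α] [Primcodable β] {f : α → ℕ}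
    {g : α → ℕ → β} (hf : Computable f) (hg : Computable₂ g) :
    Computable fun a => (List.range (f a)).map (g a) := by
  have h : Computable₂ fun (a : α) (x : ℕ × List β) => x.2 ++ [g a x.1] :=
    Computable.list_concat.comp (Computable.snd.comp Computable.snd)
      (hg.comp Computable.fst (Computable.fst.comp Computable.snd))
  refine (Computable.nat_rec hf (Computable.const []) h).of_eq fun a => ?_
  induction f a with
  | zero => rfl
  | succ n ih => simp only [ih, List.range_succ, List.map_append, List.map_cons, List.map_nil]

theorem computable_initSeg {α : Type*} [Primcodable α] {f : α → ℕ} {p : α → ℕ → ℕ}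
    (hf : Computable f) (hp : Computable₂ p) : Computable fun a => initSeg (p a) (f a) :=
  computable_map_range hf hp

/-- The word function which computes the `n`-th output symbol from the first `n + 1` input
symbols. -/
def realTime (G : ℕ → List ℕ → ℕ) (σ : List ℕ) : List ℕ :=
  (List.range σ.length).map fun n => G n (σ.take (n + 1))

theorem realTime_mono (G : ℕ → List ℕ → ℕ) {σ τ : List ℕ} (h : σ <+: τ) :
    realTime G σ <+: realTime G τ := by
  have hl := h.length_le
  have : realTime G σ = (realTime G τ).take σ.length := by
    simp only [realTime, ← List.map_take, List.take_range, min_eq_left hl]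
    apply List.map_congr_left
    intro n hn
    rw [List.mem_range] at hn
    rw [List.prefix_iff_eq_take.1 h, List.take_take, min_eq_left (by simpa [hl] using hn)]
  rw [this]
  exact List.take_prefix _ _

theorem computes_realTime (G : ℕ → List ℕ → ℕ) (p : ℕ → ℕ) :
    Representation.Computes (realTime G) p fun n => G n (initSeg p (n + 1)) := by
  intro n
  refine ⟨n + 1, ?_⟩
  simp [realTime, take_initSeg]

theorem computable_realTime {G : ℕ → List ℕ → ℕ} (hG : Computable₂ G) :
    Computable (realTime G) := by
  refine computable_map_range Computable.list_length ?_
  exact hG.comp Computable.snd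
    (Primrec.list_take.to_comp.comp (Computable.succ.comp Computable.snd) Computable.fst)

/-- The value of `S` at the shortest prefix of `σ`, of length less than `n`, where `S` has a
value. -/
def firstValue (S : List ℕ → Option ℕ) (σ : List ℕ) (n : ℕ) : Option ℕ :=
  Nat.rec none (fun t r => r.or (S (σ.take t))) n

theorem firstValue_succ (S : List ℕ → Option ℕ) (σ : List ℕ) (n : ℕ) :
    firstValue S σ (n + 1) = (firstValue S σ n).or (S (σ.take n)) := rfl

theorem firstValue_mono {S : List ℕ → Option ℕ} {σ : List ℕ} {m n a : ℕ} (h : m ≤ n)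
    (ha : firstValue S σ m = some a) : firstValue S σ n = some a := by
  induction n, h using Nat.le_induction with
  | base => exact ha
  | succ n _ ih => simp [firstValue_succ, ih]

theorem firstValue_congr (S : List ℕ → Option ℕ) {σ τ : List ℕ} (h : σ <+: τ) {n : ℕ}
    (hn : n ≤ σ.length) : firstValue S σ n = firstValue S τ n := by
  induction n with
  | zero => rfl
  | succ n ih =>
    rw [firstValue_succ, firstValue_succ, ih (by omega), List.prefix_iff_eq_take.1 h,
      List.take_take, min_eq_left (by omega)]

theorem exists_of_firstValue {S : List ℕ → Option ℕ} {σ : List ℕ} {n a : ℕ}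
    (h : firstValue S σ n = some a) : ∃ t, S (σ.take t) = some a := by
  induction n with
  | zero => cases h
  | succ n ih =>
    rw [firstValue_succ, Option.or_eq_some_iff] at h
    rcases h with h | h
    · exact ih h
    · exact ⟨n, h.2⟩

theorem firstValue_isSome {S : List ℕ → Option ℕ} {σ : List ℕ} {n t : ℕ} (ht : t < n)
    (h : (S (σ.take t)).isSome) : (firstValue S σ n).isSome := by
  have h1 : (firstValue S σ (t + 1)).isSome := by simp [firstValue_succ, h]
  obtain ⟨a, ha⟩ := Option.isSome_iff_exists.1 h1
  rw [firstValue_mono ht ha]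
  rfl

/-- The word function which searches for the first prefix of the input with a value under `S` and
then outputs this value forever. -/
def search (S : List ℕ → Option ℕ) (σ : List ℕ) : List ℕ :=
  ((firstValue S σ σ.length).map fun a => initSeg (fun _ => a) σ.length).getD []

theorem search_mono (S : List ℕ → Option ℕ) {σ τ : List ℕ} (h : σ <+: τ) :
    search S σ <+: search S τ := by
  unfold search
  cases hv : firstValue S σ σ.length with
  | none => simp
  | some a =>
    rw [firstValue_congr S h le_rfl] at hv
    rw [firstValue_mono h.length_le hv]
    exact initSeg_prefix _ h.length_le

/-- The answer is some value of `S` on a prefix of the input, so a specification of `search S` only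
needs every value of `S` to be sound and one value to exist. -/
theorem computes_search {S : List ℕ → Option ℕ} {p : ℕ → ℕ} {t : ℕ}
    (h : (S (initSeg p t)).isSome) :
    ∃ a s, S (initSeg p s) = some a ∧ Representation.Computes (search S) p fun _ => a := by
  have h1 : (firstValue S (initSeg p (t + 1)) (t + 1)).isSome :=
    firstValue_isSome (Nat.lt_succ_self t) (by simpa [take_initSeg] using h)
  obtain ⟨a, ha⟩ := Option.isSome_iff_exists.1 h1
  obtain ⟨s, hs⟩ := exists_of_firstValue ha
  rw [take_initSeg] at hs
  refine ⟨a, _, hs, fun n => ⟨t + 1 + n + 1, ?_⟩⟩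
  rw [firstValue_congr S (initSeg_prefix p (by omega : t + 1 ≤ t + 1 + n + 1)) (by simp)] at ha
  simp only [search, length_initSeg]
  rw [firstValue_mono (by omega) ha]
  exact getElem?_initSeg _ (by omega)

theorem computable_search {S : List ℕ → Option ℕ} (hS : Computable S) :
    Computable (search S) := by
  have h : Computable₂ fun (σ : List ℕ) (x : ℕ × Option ℕ) => x.2.or (S (σ.take x.1)) := by
    refine (Primrec.option_orElse.to_comp.comp (Computable.snd.comp Computable.snd)
      (hS.comp (Primrec.list_take.to_comp.comp (Computable.fst.comp Computable.snd)
        Computable.fst))).of_eq fun x => ?_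
    obtain ⟨σ, t, r⟩ := x
    cases r <;> simp
  refine Computable.option_getD (Computable.option_map
    (Computable.nat_rec Computable.list_length (Computable.const none) h) ?_) (Computable.const [])
  exact computable_initSeg (Computable.list_length.comp Computable.fst)
    (Computable.snd.comp Computable.fst)

end WordFunctions

/-! ### Enumerating a computably enumerable predicate -/

theorem exists_enumeration {α : Type*} [Primcodable α] {P : α → Prop} (h : REPred P) :
    ∃ e : ℕ → Option α, Computable e ∧ ∀ a, P a ↔ ∃ k, e k = some a := by
  obtain ⟨c, hc⟩ := Nat.Partrec.Code.exists_code.1 h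
  -- Dovetailing: k codes a candidate and a step bound. `none` marks an unsuccessful run, so an
  -- empty predicate causes no trouble.
  refine ⟨fun k => (Encodable.decode (α := α) k.unpair.1).bind fun a =>
    (Nat.Partrec.Code.evaln k.unpair.2 c (Encodable.encode a)).map fun _ => a, ?_, fun a => ?_⟩
  · refine Primrec.to_comp ?_
    refine Primrec.option_bind (Primrec.decode.comp (Primrec.fst.comp Primrec.unpair)) ?_
    refine Primrec.option_map (Nat.Partrec.Code.primrec_evaln.comp
      (Primrec.pair (Primrec.pair (Primrec.snd.comp (Primrec.unpair.comp Primrec.fst))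
        (Primrec.const c)) (Primrec.encode.comp Primrec.snd))) ?_
    exact Primrec.snd.comp Primrec.fst
  · have key : P a ↔ ∃ k x, x ∈ Nat.Partrec.Code.evaln k c (Encodable.encode a) := by
      rw [exists_comm]
      simp only [← Nat.Partrec.Code.evaln_complete, hc]
      simp [Encodable.encodek]
    rw [key]
    constructor
    · rintro ⟨k, x, hx⟩
      refine ⟨Nat.pair (Encodable.encode a) k, ?_⟩
      rw [Option.mem_def] at hx
      simp [Encodable.encodek, hx]
    · rintro ⟨k, hk⟩
      simp only [Option.bind_eq_some_iff, Option.map_eq_some_iff] at hk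
      obtain ⟨b, -, x, hx, rfl⟩ := hk
      exact ⟨_, x, hx⟩

end TTE

/-! ### The embedding into 𝕋^ω -/

namespace TTE.Representation

variable {X : Type u} {δ : Representation X}

open Classical in
/-- The map `(𝒜 ∧ 𝒱)(X) → 𝕋^ω` induced by sequences `U`, `B` and an enumeration `e` of pairs of
indices: if `e k = some (m, n)`, then the `k`-th coordinate of the value at `A` is `1` if `U m`
meets `A` and `0` if `B n` is disjoint from `A`. -/
noncomputable def probe (U : ℕ → δ.OpenSets) (B : ℕ → δ.CompactSets) (e : ℕ → Option (ℕ × ℕ))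
    (A : δ.ClosedSets) (k : ℕ) : Option Bool :=
  (e k).bind fun a => if ((U a.1).1 ∩ A.1).Nonempty then some true
    else if (B a.2).1 ⊆ A.1ᶜ then some false else none

section

variable {U : ℕ → δ.OpenSets} {B : ℕ → δ.CompactSets} {R : ℕ → ℕ → Prop}
  {e : ℕ → Option (ℕ × ℕ)}

theorem probe_eq_true {A : δ.ClosedSets} {k : ℕ} :
    probe U B e A k = some true ↔ ∃ a, e k = some a ∧ ((U a.1).1 ∩ A.1).Nonempty := by
  unfold probe
  rw [Option.bind_eq_some_iff]
  refine exists_congr fun a => and_congr_right fun _ => ?_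
  split_ifs with h1 h2 <;> simp [h1]

/-- The priority that `probe` gives to the value 1 is harmless: a point of U_m ∩ A lies in B_n, so
B_n is then not disjoint from A. -/
theorem IsErcs.probe_eq_false (h : δ.IsErcs U B R) (he : ∀ a, R a.1 a.2 ↔ ∃ k, e k = some a)
    {A : δ.ClosedSets} {k : ℕ} :
    probe U B e A k = some false ↔ ∃ a, e k = some a ∧ (B a.2).1 ⊆ A.1ᶜ := by
  unfold probe
  rw [Option.bind_eq_some_iff]
  refine exists_congr fun a => and_congr_right fun ha => ?_
  split_ifs with h1 h2
  · obtain ⟨x, hxU, hxA⟩ := h1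
    have hx := h.subset_of_rel _ _ ((he a).2 ⟨k, ha⟩) hxU
    simpa using fun hB : (B a.2).1 ⊆ A.1ᶜ => hB hx hxA
  · simp [h2]
  · simp [h2]

theorem IsErcs.mem_iff (h : δ.IsErcs U B R) (he : ∀ a, R a.1 a.2 ↔ ∃ k, e k = some a)
    (W : δ.OpenSets) (x : X) :
    x ∈ W.1 ↔ ∃ k a, e k = some a ∧ (B a.2).1 ⊆ W.1 ∧ x ∈ (U a.1).1 := by
  conv_lhs => rw [h.eq_iUnion W]
  simp only [Set.mem_iUnion, Set.mem_ofPred_eq, exists_prop]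
  constructor
  · rintro ⟨n, hn, m, hm, hx⟩
    obtain ⟨k, hk⟩ := (he (m, n)).1 hm
    exact ⟨k, _, hk, hn, hx⟩
  · rintro ⟨k, a, hk, hB, hx⟩
    exact ⟨_, hB, _, (he a).2 ⟨k, hk⟩, hx⟩

theorem IsErcs.mem_compl_iff (h : δ.IsErcs U B R) (he : ∀ a, R a.1 a.2 ↔ ∃ k, e k = some a)
    (A : δ.ClosedSets) (x : X) :
    x ∈ A.1ᶜ ↔ ∃ k a, e k = some a ∧ probe U B e A k = some false ∧ x ∈ (U a.1).1 := by
  rw [h.mem_iff he ⟨_, A.2⟩]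
  refine exists_congr fun k => exists_congr fun a => and_congr_right fun ha => ?_
  rw [h.probe_eq_false he]
  simp [ha]

theorem IsErcs.inter_nonempty_iff (h : δ.IsErcs U B R)
    (he : ∀ a, R a.1 a.2 ↔ ∃ k, e k = some a) (A : δ.ClosedSets) (V : δ.OpenSets) :
    (V.1 ∩ A.1).Nonempty ↔
      ∃ k a, e k = some a ∧ probe U B e A k = some true ∧ (B a.2).1 ⊆ V.1 := by
  constructor
  · rintro ⟨x, hxV, hxA⟩
    obtain ⟨k, a, ha, hB, hx⟩ := (h.mem_iff he V x).1 hxV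
    exact ⟨k, a, ha, probe_eq_true.2 ⟨a, ha, x, hx, hxA⟩, hB⟩
  · rintro ⟨k, a, ha, ht, hB⟩
    obtain ⟨a', ha', x, hx, hxA⟩ := probe_eq_true.1 ht
    obtain rfl : a = a' := Option.some_injective _ (ha.symm.trans ha')
    exact ⟨x, (h.mem_iff he V x).2 ⟨k, a, ha, hB, hx⟩, hxA⟩

theorem IsErcs.probe_injective (h : δ.IsErcs U B R)
    (he : ∀ a, R a.1 a.2 ↔ ∃ k, e k = some a) : Function.Injective (probe U B e) := by
  intro A A' hA
  refine Subtype.ext (compl_injective (Set.ext fun x => ?_))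
  rw [h.mem_compl_iff he, h.mem_compl_iff he, hA]

end

/-- The entries of a name of `probe U B e A`, computed from prefixes `σ` of a name of `A`. -/
def probeEntry (u b : ℕ → ℕ → ℕ) (e : ℕ → Option (ℕ × ℕ)) (N : ℕ) (σ : List ℕ) : ℕ :=
  ((e N.unpair.1).map fun a =>
    -- Here N codes (k, ((i, l), s)): coordinate k, entry i of a name to inspect, length l of the
    -- prefix to compare it with, and a padding s that delays the test until enough of σ is
    -- available.
    bif (σ.getD (2 * N.unpair.2.unpair.1.unpair.1 + 1) 0 ==
      Encodable.encode (initSeg (u a.1) N.unpair.2.unpair.1.unpair.2) + 1) then 2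
    else bif (b a.2 N.unpair.2.unpair.1.unpair.1 ==
      Encodable.encode ((evensWord σ).take N.unpair.2.unpair.1.unpair.2) + 1) then 1
    else 0).getD 0

/-- The entries of a name of `A`, computed from prefixes `ζ` of a name of `probe U B e A`. -/
def recoverEntry (u b : ℕ → ℕ → ℕ) (e : ℕ → Option (ℕ × ℕ)) (N : ℕ) (ζ : List ℕ) : ℕ :=
  ((e (N / 2).unpair.1.unpair.1).map fun a =>
    bif ζ.getD (N / 2).unpair.1 0 == N % 2 + 1 then
      bif N % 2 == 0 then u a.1 (N / 2).unpair.2 else b a.2 (N / 2).unpair.2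
    else 0).getD 0

theorem computable_probeEntry {u b : ℕ → ℕ → ℕ} {e : ℕ → Option (ℕ × ℕ)}
    (hu : Computable₂ u) (hb : Computable₂ b) (he : Computable e) :
    Computable₂ (probeEntry u b e) := by
  have fstU : Computable fun n : ℕ => n.unpair.1 := Computable.fst.comp Computable.unpair
  have sndU : Computable fun n : ℕ => n.unpair.2 := Computable.snd.comp Computable.unpair
  refine Computable.option_getD (Computable.option_map
    (he.comp (fstU.comp Computable.fst)) ?_) (Computable.const 0)
  have hN : Computable fun x : (ℕ × List ℕ) × ℕ × ℕ => x.1.1.unpair.2.unpair.1 :=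
    fstU.comp (sndU.comp (Computable.fst.comp Computable.fst))
  have hi := fstU.comp hN
  have hl := sndU.comp hN
  have hσ : Computable fun x : (ℕ × List ℕ) × ℕ × ℕ => x.1.2 :=
    Computable.snd.comp Computable.fst
  refine Computable.cond (Primrec.beq.to_comp.comp ?_ ?_) (Computable.const 2)
    (Computable.cond (Primrec.beq.to_comp.comp ?_ ?_) (Computable.const 1) (Computable.const 0))
  · exact (Primrec.list_getD 0).to_comp.comp hσ (Computable.succ.comp
      (Primrec.nat_mul.to_comp.comp (Computable.const 2) hi))
  · refine Computable.succ.comp (Computable.encode.comp (computable_initSeg hl ?_))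
    exact hu.comp (Computable.fst.comp (Computable.snd.comp Computable.fst)) Computable.snd
  · exact hb.comp (Computable.snd.comp Computable.snd) hi
  · exact Computable.succ.comp (Computable.encode.comp (Primrec.list_take.to_comp.comp hl
      (primrec_evensWord.to_comp.comp hσ)))

theorem computable_recoverEntry {u b : ℕ → ℕ → ℕ} {e : ℕ → Option (ℕ × ℕ)}
    (hu : Computable₂ u) (hb : Computable₂ b) (he : Computable e) :
    Computable₂ (recoverEntry u b e) := by
  have fstU : Computable fun n : ℕ => n.unpair.1 := Computable.fst.comp Computable.unpair
  have sndU : Computable fun n : ℕ => n.unpair.2 := Computable.snd.comp Computable.unpair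
  have half : Computable fun n : ℕ => n / 2 :=
    Primrec.nat_div.to_comp.comp Computable.id (Computable.const 2)
  have par : Computable fun n : ℕ => n % 2 :=
    Primrec.nat_mod.to_comp.comp Computable.id (Computable.const 2)
  refine Computable.option_getD (Computable.option_map
    (he.comp (fstU.comp (fstU.comp (half.comp Computable.fst)))) ?_) (Computable.const 0)
  have hN : Computable fun x : (ℕ × List ℕ) × ℕ × ℕ => x.1.1 :=
    Computable.fst.comp Computable.fst
  have hσ : Computable fun x : (ℕ × List ℕ) × ℕ × ℕ => x.1.2 :=
    Computable.snd.comp Computable.fst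
  have hi := sndU.comp (half.comp hN)
  refine Computable.cond (Primrec.beq.to_comp.comp ?_ ?_)
    (Computable.cond (Primrec.beq.to_comp.comp ?_ ?_) ?_ ?_) (Computable.const 0)
  · exact (Primrec.list_getD 0).to_comp.comp hσ (fstU.comp (half.comp hN))
  · exact Computable.succ.comp (par.comp hN)
  · exact par.comp hN
  · exact Computable.const 0
  · exact hu.comp (Computable.fst.comp Computable.snd) hi
  · exact hb.comp (Computable.snd.comp Computable.snd) hi

/-! ### Correctness of the two realizers -/

section

variable {U : ℕ → δ.OpenSets} {B : ℕ → δ.CompactSets} {R : ℕ → ℕ → Prop}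
  {e : ℕ → Option (ℕ × ℕ)} {u b : ℕ → ℕ → ℕ}

theorem IsErcs.names_probe (h : δ.IsErcs U B R) (he : ∀ a, R a.1 a.2 ↔ ∃ k, e k = some a)
    (hu : ∀ n, δ.opens.Names (u n) (U n)) (hb : ∀ n, δ.compacts.Names (b n) (B n))
    {p : ℕ → ℕ} {A : δ.ClosedSets} (hp : δ.closedOverts.Names p A) :
    three.power.Names (fun N => probeEntry u b e N (initSeg p (N + 1))) (probe U B e A) := by
  obtain ⟨hpA, hpV⟩ := hp
  have hit : ∀ m, ((U m).1 ∩ A.1).Nonempty ↔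
      ∃ i l, odds p i = Encodable.encode (initSeg (u m) l) + 1 := fun m => hpV _ _ (hu m)
  have miss : ∀ n, (B n).1 ⊆ A.1ᶜ ↔
      ∃ i l, b n i = Encodable.encode (initSeg (evens p) l) + 1 := fun n =>
    hb n (evens p) ⟨_, A.2⟩ hpA
  -- The padding 2i + 2l + 1 bounds N from below, so the input read so far contains entry i of its
  -- odd half and l symbols of its even half.
  have pad : ∀ k i l, 2 * i + 1 < Nat.pair k (Nat.pair (Nat.pair i l) (2 * i + 2 * l + 1)) + 1 ∧
      2 * l < Nat.pair k (Nat.pair (Nat.pair i l) (2 * i + 2 * l + 1)) + 1 := by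
    intro k i l
    have h1 := Nat.right_le_pair (Nat.pair i l) (2 * i + 2 * l + 1)
    have h2 := Nat.right_le_pair k (Nat.pair (Nat.pair i l) (2 * i + 2 * l + 1))
    omega
  have sound1 : ∀ {a : ℕ × ℕ} {N : ℕ},
      (initSeg p (N + 1)).getD (2 * N.unpair.2.unpair.1.unpair.1 + 1) 0 =
        Encodable.encode (initSeg (u a.1) N.unpair.2.unpair.1.unpair.2) + 1 →
      ((U a.1).1 ∩ A.1).Nonempty := by
    intro a N hN
    refine (hit a.1).2 ⟨N.unpair.2.unpair.1.unpair.1, N.unpair.2.unpair.1.unpair.2, ?_⟩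
    rw [← hN]
    by_cases hlt : 2 * N.unpair.2.unpair.1.unpair.1 + 1 < N + 1
    · rw [List.getD_eq_getElem?_getD, getElem?_initSeg p hlt]
      rfl
    -- The default 0 is never a code plus one, so a position not yet read cannot cause a match.
    · rw [List.getD_eq_default _ _ (by simpa using hlt)] at hN
      omega
  intro k c
  cases c with
  | true =>
    rw [probe_eq_true]
    constructor
    · rintro ⟨a, ha, hne⟩
      obtain ⟨i, l, hil⟩ := (hit a.1).1 hne
      refine ⟨Nat.pair (Nat.pair i l) (2 * i + 2 * l + 1), ?_⟩
      simp only [row, probeEntry, Nat.unpair_pair, ha, Option.map_some, Option.getD_some]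
      rw [List.getD_eq_getElem?_getD, getElem?_initSeg p (pad k i l).1]
      have : p (2 * i + 1) = _ := hil
      simp [this]
    · rintro ⟨s, hs⟩
      simp only [row, probeEntry, Nat.unpair_pair] at hs
      cases ha : e k with
      | none => simp [ha] at hs
      | some a =>
        refine ⟨a, rfl, sound1 (N := Nat.pair k s) ?_⟩
        simp only [Nat.unpair_pair]
        by_contra hne
        simp only [ha, Option.map_some, Option.getD_some, beq_eq_false_iff_ne.2 hne,
          cond_false] at hs
        revert hs
        cases (b a.2 s.unpair.1.unpair.1 == _) <;> simp
  | false =>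
    rw [h.probe_eq_false he]
    constructor
    · rintro ⟨a, ha, hsub⟩
      obtain ⟨i, l, hil⟩ := (miss a.2).1 hsub
      refine ⟨Nat.pair (Nat.pair i l) (2 * i + 2 * l + 1), ?_⟩
      -- The test for 2 runs first and has to fail here: success would give a point of A in U_m ⊆
      -- B_n ⊆ Aᶜ.
      have hne : ¬ (initSeg p (Nat.pair k (Nat.pair (Nat.pair i l) (2 * i + 2 * l + 1)) + 1)).getD
          (2 * i + 1) 0 = Encodable.encode (initSeg (u a.1) l) + 1 := by
        intro heq
        obtain ⟨x, hxU, hxA⟩ := sound1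
          (N := Nat.pair k (Nat.pair (Nat.pair i l) (2 * i + 2 * l + 1))) (by simpa using heq)
        exact hsub (h.subset_of_rel _ _ ((he a).2 ⟨k, ha⟩) hxU) hxA
      have hl : min l ((Nat.pair k (Nat.pair (Nat.pair i l) (2 * i + 2 * l + 1)) + 1 + 1) / 2) = l
          := by
        have := (pad k i l).2
        omega
      simp only [row, probeEntry, Nat.unpair_pair, ha, Option.map_some, Option.getD_some,
        beq_eq_false_iff_ne.2 hne, cond_false, evensWord_initSeg, take_initSeg, hl]
      simp [hil]
    · rintro ⟨s, hs⟩
      simp only [row, probeEntry, Nat.unpair_pair] at hs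
      cases ha : e k with
      | none => simp [ha] at hs
      | some a =>
        refine ⟨a, rfl, (miss a.2).2 ?_⟩
        simp only [ha, Option.map_some, Option.getD_some, evensWord_initSeg, take_initSeg] at hs
        refine ⟨s.unpair.1.unpair.1,
          min s.unpair.1.unpair.2 ((Nat.pair k s + 1 + 1) / 2), ?_⟩
        by_contra hne
        rw [beq_eq_false_iff_ne.2 hne] at hs
        revert hs
        cases ((initSeg p (Nat.pair k s + 1)).getD (2 * s.unpair.1.unpair.1 + 1) 0 == _) <;> simp

/-- Interleaving names of open sets names their union. The even half merges the names of the U_m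
with coordinate 0, giving Aᶜ; the odd half merges the names of the B_n with coordinate 1, giving the
open sets that meet A. -/
theorem IsErcs.names_recover (h : δ.IsErcs U B R) (he : ∀ a, R a.1 a.2 ↔ ∃ k, e k = some a)
    (hu : ∀ n, δ.opens.Names (u n) (U n)) (hb : ∀ n, δ.compacts.Names (b n) (B n))
    {z : ℕ → ℕ} {A : δ.ClosedSets} (hz : three.power.Names z (probe U B e A)) :
    δ.closedOverts.Names (fun N => recoverEntry u b e N (initSeg z (N + 1))) A := by
  have get : ∀ N, (initSeg z (N + 1)).getD (N / 2).unpair.1 0 = z (N / 2).unpair.1 := by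
    intro N
    have := Nat.unpair_left_le (N / 2)
    rw [List.getD_eq_getElem?_getD, getElem?_initSeg z (by omega)]
    rfl
  have value : ∀ N x, recoverEntry u b e N (initSeg z (N + 1)) = x + 1 ↔
      ∃ a, e (N / 2).unpair.1.unpair.1 = some a ∧ z (N / 2).unpair.1 = N % 2 + 1 ∧
        (bif N % 2 == 0 then u a.1 (N / 2).unpair.2 else b a.2 (N / 2).unpair.2) = x + 1 := by
    intro N x
    simp only [recoverEntry, get]
    cases e (N / 2).unpair.1.unpair.1 with
    | none => simp
    | some a =>
      by_cases hza : z (N / 2).unpair.1 = N % 2 + 1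
      · simp [hza]
      · simp [hza, beq_eq_false_iff_ne.2 hza]
  have mem : ∀ k (c : Bool), probe U B e A k = some c ↔ ∃ j, j.unpair.1 = k ∧ z j = c.toNat + 1 := by
    intro k c
    refine (hz k c).trans ⟨fun ⟨s, hs⟩ => ⟨Nat.pair k s, by simp, hs⟩, ?_⟩
    rintro ⟨j, rfl, hj⟩
    exact ⟨j.unpair.2, by simpa [row] using hj⟩
  refine ⟨fun q x hq => ?_, fun v V hv => ?_⟩
  · rw [h.mem_compl_iff he]
    simp only [evens, value]
    constructor
    · rintro ⟨k, a, ha, hk, hx⟩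
      obtain ⟨j, rfl, hj⟩ := (mem _ _).1 hk
      obtain ⟨i, l, hil⟩ := (hu a.1 q x hq).1 hx
      exact ⟨Nat.pair j i, l, a, by simpa using ha, by simpa using hj, by simpa using hil⟩
    · rintro ⟨M, l, a, ha, hj, hil⟩
      simp only [Nat.mul_div_cancel_left M (Nat.succ_pos 1), Nat.mul_mod_right] at ha hj hil
      exact ⟨_, a, ha, (mem _ false).2 ⟨_, rfl, hj⟩, (hu a.1 q x hq).2 ⟨_, l, hil⟩⟩
  · refine (h.inter_nonempty_iff he A V).trans ?_
    have hdiv : ∀ M, (2 * M + 1) / 2 = M := fun M => by omega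
    have hmod : ∀ M, (2 * M + 1) % 2 = 1 := fun M => by omega
    simp only [odds, value, hdiv, hmod]
    constructor
    · rintro ⟨k, a, ha, hk, hx⟩
      obtain ⟨j, rfl, hj⟩ := (mem _ _).1 hk
      obtain ⟨i, l, hil⟩ := (hb a.2 v V hv).1 hx
      exact ⟨Nat.pair j i, l, a, by simpa using ha, by simpa using hj, by simpa using hil⟩
    · rintro ⟨M, l, a, ha, hj, hil⟩
      exact ⟨_, a, ha, (mem _ true).2 ⟨_, rfl, hj⟩, (hb a.2 v V hv).2 ⟨_, l, hil⟩⟩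

theorem IsErcs.computableEmbedding_probe (h : δ.IsErcs U B R) (hec : Computable e)
    (he : ∀ a, R a.1 a.2 ↔ ∃ k, e k = some a) :
    δ.closedOverts.ComputableEmbedding three.power (probe U B e) := by
  obtain ⟨u, huc, hu⟩ := h.computable_opens
  obtain ⟨b, hbc, hb⟩ := h.computable_compacts
  refine ⟨h.probe_injective he,
    ⟨realTime (probeEntry u b e), computable_realTime (computable_probeEntry huc hbc hec),
      fun _ _ => realTime_mono _, fun p A hp _ =>
        ⟨_, _, computes_realTime _ p, h.names_probe he hu hb hp, rfl⟩⟩,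
    ⟨realTime (recoverEntry u b e), computable_realTime (computable_recoverEntry huc hbc hec),
      fun _ _ => realTime_mono _, ?_⟩⟩
  rintro z _ hz ⟨A, rfl⟩
  exact ⟨_, A, computes_realTime _ z, h.names_recover he hu hb hz, rfl⟩

end

theorem AdmitsErcs.exists_computableEmbedding (hX : δ.AdmitsErcs) :
    ∃ φ : δ.ClosedSets → ℕ → Option Bool, δ.closedOverts.ComputableEmbedding three.power φ := by
  obtain ⟨U, B, R, h⟩ := hX
  obtain ⟨e, hec, he⟩ := exists_enumeration h.enumerable
  exact ⟨_, h.computableEmbedding_probe hec he⟩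

end TTE.Representation

/-! ### An effective basis for spaces embedded in 𝕋^ω -/

namespace TTE

/-- Every announcement in the word `ζ` (viewed as part of a name of a point of `𝕋^ω`) is also made
in `τ`. -/
def Settles (ζ τ : List ℕ) : Prop :=
  ∀ j < ζ.length, ζ.getD j 0 = 0 ∨ 2 < ζ.getD j 0 ∨
    ∃ l < τ.length, l.unpair.1 = j.unpair.1 ∧ τ.getD l 0 = ζ.getD j 0

/-- The word `ω` lists a prefix of `ρ` (in the sense of names of open sets). -/
def Lists (ω ρ : List ℕ) : Prop :=
  ∃ i < ω.length, ∃ k < ρ.length + 1, ω.getD i 0 = Encodable.encode (ρ.take k) + 1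

theorem primrecRel_exists_lt {β : Type*} [Primcodable β] {R : ℕ → β → Prop}
    (h : PrimrecRel R) : PrimrecRel fun n b => ∃ x < n, R x b :=
  (h.exists_mem_list.comp (Primrec.list_range.comp Primrec.fst) Primrec.snd).of_eq (by simp)

theorem primrecRel_forall_lt {β : Type*} [Primcodable β] {R : ℕ → β → Prop}
    (h : PrimrecRel R) : PrimrecRel fun n b => ∀ x < n, R x b :=
  (h.forall_mem_list.comp (Primrec.list_range.comp Primrec.fst) Primrec.snd).of_eq (by simp)

theorem primrecRel_settles : PrimrecRel Settles := by
  have h0 : PrimrecRel fun (l : ℕ) (x : ℕ × List ℕ × List ℕ) =>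
      l.unpair.1 = x.1.unpair.1 ∧ x.2.2.getD l 0 = x.2.1.getD x.1 0 := by
    have hx : Primrec fun a : ℕ × ℕ × List ℕ × List ℕ => a.2 := Primrec.snd
    refine PrimrecPred.and (Primrec.eq.comp (Primrec.fst.comp (Primrec.unpair.comp Primrec.fst))
      (Primrec.fst.comp (Primrec.unpair.comp (Primrec.fst.comp hx)))) (Primrec.eq.comp ?_ ?_)
    · exact (Primrec.list_getD 0).comp (Primrec.snd.comp (Primrec.snd.comp hx)) Primrec.fst
    · exact (Primrec.list_getD 0).comp (Primrec.fst.comp (Primrec.snd.comp hx))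
        (Primrec.fst.comp hx)
  have h1 : PrimrecPred fun x : ℕ × List ℕ × List ℕ => ∃ l < x.2.2.length,
      l.unpair.1 = x.1.unpair.1 ∧ x.2.2.getD l 0 = x.2.1.getD x.1 0 := by
    have := (primrecRel_exists_lt h0).comp (Primrec.list_length.comp
      (Primrec.snd.comp (Primrec.snd (α := ℕ) (β := List ℕ × List ℕ)))) Primrec.id
    exact this
  have hd : Primrec fun x : ℕ × List ℕ × List ℕ => x.2.1.getD x.1 0 :=
    (Primrec.list_getD 0).comp (Primrec.fst.comp Primrec.snd) Primrec.fst
  have h2 : PrimrecRel fun (j : ℕ) (x : List ℕ × List ℕ) =>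
      x.1.getD j 0 = 0 ∨ 2 < x.1.getD j 0 ∨
        ∃ l < x.2.length, l.unpair.1 = j.unpair.1 ∧ x.2.getD l 0 = x.1.getD j 0 :=
    (Primrec.eq.comp hd (Primrec.const 0)).or ((Primrec.nat_lt.comp (Primrec.const 2) hd).or h1)
  exact (primrecRel_forall_lt h2).comp (Primrec.list_length.comp Primrec.fst) Primrec.id

theorem primrecRel_lists : PrimrecRel Lists := by
  have h0 : PrimrecRel fun (k : ℕ) (x : ℕ × List ℕ × List ℕ) =>
      x.2.1.getD x.1 0 = Encodable.encode (x.2.2.take k) + 1 := by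
    have hx : Primrec fun a : ℕ × ℕ × List ℕ × List ℕ => a.2 := Primrec.snd
    refine Primrec.eq.comp ((Primrec.list_getD 0).comp (Primrec.fst.comp (Primrec.snd.comp hx))
      (Primrec.fst.comp hx)) (Primrec.succ.comp (Primrec.encode.comp ?_))
    exact Primrec.list_take.comp Primrec.fst (Primrec.snd.comp (Primrec.snd.comp hx))
  have h1 : PrimrecRel fun (i : ℕ) (x : List ℕ × List ℕ) =>
      ∃ k < x.2.length + 1, x.1.getD i 0 = Encodable.encode (x.2.take k) + 1 := by
    have := (primrecRel_exists_lt h0).comp (Primrec.succ.comp (Primrec.list_length.comp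
      (Primrec.snd.comp (Primrec.snd (α := ℕ) (β := List ℕ × List ℕ))))) Primrec.id
    exact this
  exact (primrecRel_exists_lt h1).comp (Primrec.list_length.comp Primrec.fst) Primrec.id

theorem getD_initSeg (p : ℕ → ℕ) {k n : ℕ} (h : n < k) : (initSeg p k).getD n 0 = p n := by
  rw [List.getD_eq_getElem?_getD, getElem?_initSeg p h]
  rfl

theorem lists_initSeg {w q : ℕ → ℕ} {m l : ℕ} :
    Lists (initSeg w m) (initSeg q l) ↔
      ∃ i < m, ∃ k ≤ l, w i = Encodable.encode (initSeg q k) + 1 := by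
  simp only [Lists, length_initSeg, take_initSeg]
  refine exists_congr fun i => and_congr_right fun hi => exists_congr fun k => ?_
  rw [getD_initSeg w hi, Nat.lt_succ_iff]
  exact and_congr_right fun hk => by rw [min_eq_left hk]

namespace Representation

/-- The point `t` of `𝕋^ω` agrees with all announcements in the word `ζ`. -/
def Fits (ζ : List ℕ) (t : ℕ → Option Bool) : Prop :=
  ∀ j < ζ.length, ∀ b : Bool, ζ.getD j 0 = b.toNat + 1 → t j.unpair.1 = some b

theorem names_power_three {z : ℕ → ℕ} {t : ℕ → Option Bool} (hz : three.power.Names z t)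
    (r : ℕ) (b : Bool) : t r = some b ↔ ∃ s, z (Nat.pair r s) = b.toNat + 1 :=
  hz r b

theorem fits_initSeg {z : ℕ → ℕ} {t : ℕ → Option Bool} (hz : three.power.Names z t) (m : ℕ) :
    Fits (initSeg z m) t := by
  intro j hj b hb
  rw [length_initSeg] at hj
  rw [getD_initSeg z hj] at hb
  exact (names_power_three hz _ b).2 ⟨j.unpair.2, by rwa [Nat.pair_unpair]⟩

/-- A word that fits `t` extends to a name of `t`. -/
theorem exists_names_of_fits {ζ : List ℕ} {t : ℕ → Option Bool} (h : Fits ζ t) :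
    ∃ z, three.power.Names z t ∧ ζ = initSeg z ζ.length := by
  obtain ⟨z, hz⟩ := three.power.surj t
  -- Each row of z is shifted by the length of ζ, so none of its entries is overwritten; the
  -- truncated subtraction only repeats entries of the same row.
  refine ⟨fun j => if j < ζ.length then ζ.getD j 0
    else z (Nat.pair j.unpair.1 (j.unpair.2 - ζ.length)), fun r b => ?_, ?_⟩
  · constructor
    · intro hr
      obtain ⟨s, hs⟩ := (names_power_three hz r b).1 hr
      refine ⟨s + ζ.length, ?_⟩
      have : ¬ Nat.pair r (s + ζ.length) < ζ.length := by
        have := Nat.right_le_pair r (s + ζ.length)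
        omega
      simpa [row, this] using hs
    · rintro ⟨s, hs⟩
      simp only [row] at hs
      split_ifs at hs with hlt
      · simpa using h _ hlt b hs
      · simp only [Nat.unpair_pair] at hs
        exact (names_power_three hz r b).2 ⟨_, hs⟩
  · apply eq_initSeg_of_getElem?
    intro n hn
    simp [hn]

/-- Fitting ζ is a finite conjunction of announcements, each of which must occur in every name of t.
This is why the basic sets are open, uniformly in ζ. -/
theorem settles_iff_fits {h : List ℕ → List ℕ} (hm : ∀ σ τ, σ <+: τ → h σ <+: h τ)
    {q z : ℕ → ℕ} (hc : Computes h q z) {t : ℕ → Option Bool} (hz : three.power.Names z t)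
    (ζ : List ℕ) : (∃ k, Settles ζ (h (initSeg q k))) ↔ Fits ζ t := by
  constructor
  · rintro ⟨k, hk⟩ j hj b hb
    rcases hk j hj with h0 | h2 | ⟨l, hl, hlj, hlb⟩
    · omega
    · cases b <;> simp only [Bool.toNat_false, Bool.toNat_true] at hb <;> omega
    · rw [hc.eq_initSeg hm, getD_initSeg z hl, hb] at hlb
      rw [← hlj]
      exact (names_power_three hz _ b).2 ⟨l.unpair.2, by rwa [Nat.pair_unpair]⟩
  · intro hf
    have key : ∀ᶠ m in Filter.atTop, ∀ j ∈ {j | j < ζ.length}, ζ.getD j 0 = 0 ∨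
        2 < ζ.getD j 0 ∨ ∃ l < m, l.unpair.1 = j.unpair.1 ∧ z l = ζ.getD j 0 := by
      refine (Filter.eventually_all_finite (Set.finite_lt_nat _)).2 fun j hj => ?_
      have hb : ζ.getD j 0 = 0 ∨ 2 < ζ.getD j 0 ∨ ∃ b : Bool, ζ.getD j 0 = b.toNat + 1 := by
        simp only [Bool.exists_bool, Bool.toNat_false, Bool.toNat_true]
        omega
      rcases hb with hb | hb | ⟨b, hb⟩
      · exact .of_forall fun _ => .inl hb
      · exact .of_forall fun _ => .inr (.inl hb)
      · obtain ⟨s, hs⟩ := (names_power_three hz _ b).1 (hf j hj b hb)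
        filter_upwards [Filter.eventually_gt_atTop (Nat.pair j.unpair.1 s)] with m hlt
        exact .inr (.inr ⟨_, hlt, by simp, hs.trans hb.symm⟩)
    obtain ⟨m, hmm⟩ := key.exists
    obtain ⟨k, hk⟩ := hc.exists_le_length hm m
    refine ⟨k, fun j hj => ?_⟩
    refine (hmm j hj).imp_right (Or.imp_right ?_)
    rintro ⟨l, hl, hlj, hlz⟩
    have hl' := hl.trans_le (hk k le_rfl)
    refine ⟨l, hl', hlj, ?_⟩
    rw [hc.eq_initSeg hm, getD_initSeg z hl', hlz]

open Classical in
/-- A represented space that computably embeds into `𝕋^ω` has an effective countable basis. -/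
theorem ComputableEmbedding.exists_isEffectiveBasis {Y : Type u} {ε : Representation Y}
    {φ : Y → ℕ → Option Bool} (hφ : ε.ComputableEmbedding three.power φ) :
    ∃ W : ℕ → ε.OpenSets, ε.IsEffectiveBasis W := by
  obtain ⟨hinj, ⟨h, hcomp, hm, hreal⟩, g, gcomp, gm, greal⟩ := hφ
  have hh : ∀ q y, ε.Names q y → ∃ z, Computes h q z ∧ three.power.Names z (φ y) := by
    intro q y hq
    obtain ⟨z, t, hz, ht, rfl⟩ := hreal q y hq ⟨_, rfl⟩
    exact ⟨z, hz, ht⟩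
  have hg : ∀ z y, three.power.Names z (φ y) → ∃ q, Computes g z q ∧ ε.Names q y := by
    intro z y hz
    obtain ⟨q, y', hq, hy', he⟩ := greal z _ hz ⟨_, rfl⟩
    obtain rfl := hinj he
    exact ⟨q, hq, hy'⟩
  -- The name lists the word with code i exactly when `h`, run on that word, has already confirmed
  -- all announcements of the word with code n.
  let u : ℕ → ℕ → ℕ := fun n i =>
    bif decide (Settles (Denumerable.ofNat (List ℕ) n) (h (Denumerable.ofNat (List ℕ) i)))
    then i + 1 else 0
  have hu : ∀ n, ε.NamesOpen (u n) {y | Fits (Denumerable.ofNat (List ℕ) n) (φ y)} := by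
    intro n q y hq
    obtain ⟨z, hz, ht⟩ := hh q y hq
    rw [Set.mem_ofPred_eq, ← settles_iff_fits hm hz ht]
    constructor
    · rintro ⟨k, hk⟩
      exact ⟨Encodable.encode (initSeg q k), k, by simp [u, hk]⟩
    · rintro ⟨i, k, hik⟩
      refine ⟨k, ?_⟩
      by_cases hs : Settles (Denumerable.ofNat (List ℕ) n) (h (Denumerable.ofNat (List ℕ) i))
      · simp only [u, hs, decide_true, cond_true, Nat.add_right_cancel_iff] at hik
        simpa [hik] using hs
      · simp [u, hs] at hik
  let W : ℕ → ε.OpenSets := fun n => ⟨_, u n, hu n⟩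
  let S : List ℕ → Option ℕ := fun σ =>
    bif decide (Lists (oddsWord σ) (g (h (evensWord σ))))
    then some (Encodable.encode (h (evensWord σ))) else none
  have hS : Computable S := by
    have he : Computable fun σ => h (evensWord σ) := hcomp.comp primrec_evensWord.to_comp
    exact Computable.cond (primrecRel_lists.decide.to_comp.comp primrec_oddsWord.to_comp
      (gcomp.comp he)) (Computable.option_some.comp (Computable.encode.comp he))
      (Computable.const none)
  have sound : ∀ π (y : Y) (V : ε.OpenSets) s a, ε.Names (evens π) y →
      ε.opens.Names (odds π) V → S (initSeg π s) = some a → y ∈ (W a).1 ∧ (W a).1 ⊆ V.1 := by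
    intro π y V s a hy hV hs
    obtain ⟨z, hz, ht⟩ := hh _ _ hy
    simp only [S, evensWord_initSeg, oddsWord_initSeg] at hs
    set ζ := h (initSeg (evens π) ((s + 1) / 2)) with hζ
    have hpre : ζ = initSeg z ζ.length := hz.eq_initSeg hm _
    have hl : Lists (initSeg (odds π) (s / 2)) (g ζ) := by
      by_contra hl
      simp [hl] at hs
    simp only [hl, decide_true, cond_true, Option.some.injEq] at hs
    have hW : (W a).1 = {y | Fits ζ (φ y)} := by simp [W, ← hs]
    rw [hW]
    refine ⟨?_, fun y' hy' => ?_⟩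
    · rw [Set.mem_ofPred_eq, hpre]
      exact fits_initSeg ht _
    -- A name of φ y' that extends ζ makes `g` output a name of y' extending `g ζ`, which has a
    -- prefix listed by the name of V.
    · obtain ⟨z', hz', hpre'⟩ := exists_names_of_fits hy'
      obtain ⟨q, hq, hqy⟩ := hg _ _ hz'
      rw [hpre', hq.eq_initSeg gm, lists_initSeg] at hl
      obtain ⟨i, -, k, -, hik⟩ := hl
      exact (hV q y' hqy).2 ⟨i, k, hik⟩
  have complete : ∀ π (y : Y) (V : ε.OpenSets), ε.Names (evens π) y →
      ε.opens.Names (odds π) V → y ∈ V.1 → ∃ s, (S (initSeg π s)).isSome := by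
    intro π y V hy hV hyV
    obtain ⟨z, hz, ht⟩ := hh _ _ hy
    obtain ⟨q, hq, hqy⟩ := hg _ _ ht
    obtain ⟨i, k, hik⟩ := (hV q y hqy).1 hyV
    obtain ⟨m, hm'⟩ := hq.exists_le_length gm k
    obtain ⟨n, hn⟩ := hz.exists_le_length hm m
    -- Each half of the input receives about s / 2 symbols: at least n for the name of y, and more
    -- than i for the name of V.
    obtain ⟨s, hs⟩ : ∃ s, s = 2 * n + 2 * i + 2 := ⟨_, rfl⟩
    refine ⟨s, ?_⟩
    have hl : Lists (initSeg (odds π) (s / 2))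
        (g (h (initSeg (evens π) ((s + 1) / 2)))) := by
      rw [hz.eq_initSeg hm, hq.eq_initSeg gm, lists_initSeg]
      exact ⟨i, by omega, k, hm' _ (hn _ (by omega)), hik⟩
    simp [S, evensWord_initSeg, oddsWord_initSeg, hl]
  refine ⟨W, ⟨u, ?_, hu⟩, fun y V hyV => ?_, search S, computable_search hS,
    fun _ _ => search_mono S, ?_⟩
  · refine Computable.cond (primrecRel_settles.decide.to_comp.comp
      ((Primrec.ofNat (List ℕ)).to_comp.comp Computable.fst)
      (hcomp.comp ((Primrec.ofNat (List ℕ)).to_comp.comp Computable.snd)))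
      (Computable.succ.comp Computable.snd) (Computable.const 0)
  · obtain ⟨π, hπ⟩ := (ε.prod ε.opens).surj (y, V)
    obtain ⟨s, hs⟩ := complete π y V hπ.1 hπ.2 hyV
    obtain ⟨a, ha⟩ := Option.isSome_iff_exists.1 hs
    exact ⟨a, sound π y V s a hπ.1 hπ.2 ha⟩
  · rintro π ⟨y, V⟩ hπ ⟨-, hyV, -⟩
    obtain ⟨s, hs⟩ := complete π y V hπ.1 hπ.2 hyV
    obtain ⟨a, s', ha, hc⟩ := computes_search hs
    exact ⟨_, a, hc, rfl, hyV, sound π y V s' a hπ.1 hπ.2 ha⟩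

end Representation

end TTE

theorem proposition30 {X : Type u} (δ : TTE.Representation X) (hX : δ.AdmitsErcs) :
    (∃ φ : δ.ClosedSets → (ℕ → Option Bool),
      TTE.Representation.ComputableEmbedding δ.closedOverts TTE.Representation.three.power φ) ∧
    (∃ W : ℕ → δ.closedOverts.OpenSets, δ.closedOverts.IsEffectiveBasis W) := by
  obtain ⟨φ, hφ⟩ := hX.exists_computableEmbedding
  exact ⟨⟨φ, hφ⟩, hφ.exists_isEffectiveBasis⟩
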